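/- **Setting.** An instance of Unique Games on a finite simple graph $G=(V,E)$ with label set $[k]=\{0,\dots,k-1\}$ consists of a permutation $\pi_{uv}$ of $[k]$ for every edge $(u,v)\in E$ (read in the opposite direction, $\pi_{vu}=\pi_{uv}^{-1}$). A *standard-SDP solution* is a family of real vectors $\{u_i\}_{u\in V,\,i\in[k]}$ in a Euclidean space that satisfies $$\sum_{i\in[k]}\|u_i\|^2=1\ \ (u\in V),\qquad \langle u_i,u_j\rangle=0\ \ (u\in V,\ i\ne j),\qquad \langle u_i,v_j\rangle\ge 0\ \ (u,v\in V,\ i\neq j),$$ $$\|u_i-v_j\|^2\le\|u_i-w_l\|^2+\|w_l-v_j\|^2\ \ (u,v,w\in V,\ i,j,l\in[k]).$$ An edge $(u,v)\in E$ is *$\eta$-short* with respect to $\{u_i\}$ if $\frac12\sum_{i\in[k]}\|u_i-v_{\pi_{uv}(i)}\|^2\le\eta$. **Theorem.** There are absolute constants $k_0\in\mathbb N$, $c>0$, $C>0$ and a function $\delta:\mathbb N\to\mathbb R$ with $\delta(n)\to0$ as $n\to\infty$ such that the following holds. Let $k\ge k_0$ be an integer, $\varepsilon\in(0,1]$ and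 $\gamma\in(c\varepsilon/\sqrt k,\,1/\log k)$. Let $G=(V,E)$ be a simple graph on $n$ vertices with $|E|\ge C\gamma^{-1}n$, let an arbitrary instance of Unique Games on $G$ with label set $[k]$ be given, and let $E_\varepsilon\subseteq E$ be an arbitrary set of exactly $\varepsilon|E|$ edges. Replace the constraints on the edges of $E_\varepsilon$ by independent uniformly random permutations of $[k]$, and keep all other constraints. Then, with probability at least $1-\delta(n)$, it holds simultaneously for every standard-SDP solution $\{u_i\}$ that fewer than $\gamma|E|$ edges of $E_\varepsilon$ are $1/16$-short with respect to $\{u_i\}$. -/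

import Mathlib

open Filter Topology MeasureTheory ProbabilityTheory

/-- An instance of Unique Games on the constraint graph `G` with label set `{0, …, k - 1}`: one
permutation for every edge. An edge `{u, v}` is read in its two directions as two darts, and
`perm (u, v)` is `π_{uv}`, the constraint being `x_v = π_{uv} (x_u)`; read from `v` to `u`, the
same constraint is given by the inverse permutation. -/
@[ext]
structure UniqueGame {V : Type*} (G : SimpleGraph V) (k : ℕ) where
  perm : G.Dart → Equiv.Perm (Fin k)
  perm_symm : ∀ d : G.Dart, perm d.symm = (perm d)⁻¹

namespace UniqueGame

variable {V : Type*} {G : SimpleGraph V} {k : ℕ}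

/-- All instances that can arise from `I` by replacing the constraints on the edges in `S`. -/
def corruptions (I : UniqueGame G k) (S : Set (Sym2 V)) : Set (UniqueGame G k) :=
  {J | ∀ d : G.Dart, d.edge ∉ S → J.perm d = I.perm d}

/-- Events are arbitrary sets of instances. -/
instance : MeasurableSpace (UniqueGame G k) := ⊤

instance : DiscreteMeasurableSpace (UniqueGame G k) := ⟨fun _ => trivial⟩

/-- The law of the instance obtained from `I` by choosing the constraints on the edges in `S`
independently and uniformly at random among all permutations, and keeping all other constraints.
For a finite graph this is the uniform distribution on the finite set `I.corruptions S`, which is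
parametrised by one free permutation for every edge in `S`. -/
noncomputable def randomCorruption (I : UniqueGame G k) (S : Set (Sym2 V)) :
    Measure (UniqueGame G k) :=
  uniformOn (I.corruptions S)

theorem self_mem_corruptions (I : UniqueGame G k) (S : Set (Sym2 V)) : I ∈ I.corruptions S :=
  fun _ _ => rfl

instance [Finite V] : Finite (UniqueGame G k) := by
  classical
  have : Finite G.Dart := Finite.of_injective _ SimpleGraph.Dart.toProd_injective
  exact Finite.of_injective (fun I : UniqueGame G k => I.perm) fun _ _ h => UniqueGame.ext h

instance [Finite V] (I : UniqueGame G k) (S : Set (Sym2 V)) :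
    IsProbabilityMeasure (I.randomCorruption S) :=
  isProbabilityMeasure_uniformOn (Set.toFinite _) ⟨I, I.self_mem_corruptions S⟩

/-- Half the sum over the labels `i` of `‖u_i - v_{π_{uv}(i)}‖²`, for the edge read from `u`
to `v`. -/
noncomputable def length {m : ℕ} (I : UniqueGame G k)
    (x : V → Fin k → EuclideanSpace ℝ (Fin m)) (d : G.Dart) : ℝ :=
  1 / 2 * ∑ i : Fin k, ‖x d.fst i - x d.snd (I.perm d i)‖ ^ 2

/-- The length of an edge does not depend on the direction in which it is read. -/
theorem length_symm {m : ℕ} (I : UniqueGame G k)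
    (x : V → Fin k → EuclideanSpace ℝ (Fin m)) (d : G.Dart) :
    I.length x d.symm = I.length x d := by
  unfold length
  congr 1
  rw [← Equiv.sum_comp (I.perm d)]
  refine Finset.sum_congr rfl fun i _ => ?_
  rw [I.perm_symm d, norm_sub_rev]
  simp

/-- The edge `e` of `G` is `η`-short with respect to the vectors `x`. (By `length_symm` it does not
matter in which of its two directions the edge is read.) -/
def IsShort {m : ℕ} (I : UniqueGame G k) (x : V → Fin k → EuclideanSpace ℝ (Fin m))
    (η : ℝ) (e : Sym2 V) : Prop :=
  ∃ d : G.Dart, d.edge = e ∧ I.length x d ≤ η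

end UniqueGame

/-- The vectors `x u i` (one for every vertex `u` and label `i`) form a solution, that is, a
feasible point, of the standard semidefinite relaxation of Unique Games. -/
structure IsSDPSolution {V : Type*} {k m : ℕ} (x : V → Fin k → EuclideanSpace ℝ (Fin m)) :
    Prop where
  sum_norm_sq : ∀ u, ∑ i, ‖x u i‖ ^ 2 = 1
  inner_eq_zero : ∀ u i j, i ≠ j → inner ℝ (x u i) (x u j) = 0
  inner_nonneg : ∀ u v i j, i ≠ j → 0 ≤ inner ℝ (x u i) (x v j)
  triangle : ∀ u v w i j l,
    ‖x u i - x v j‖ ^ 2 ≤ ‖x u i - x w l‖ ^ 2 + ‖x w l - x v j‖ ^ 2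

/-! The proof is a union bound over short descriptions of solutions. Take `d = 70 * Nat.clog 2 k`
random hyperplanes and replace every vector by its sign pattern. Vectors at a small angle get words
at distance at most `d / 5` with constant probability (`signCode_close`); orthogonal vectors get
words at distance more than `2 * d / 5` except with probability at most `k⁻²` (`signCode_far`).
Since the squared norms at a vertex sum to 1, a uniform threshold on them keeps at most one label
per vertex in expectation. What remains is a separated `PartialEncoding`, whose cost is charged per
word and not per pair of a vertex and a label. A solution with `h` short random edges yields an
encoding with about `h / 48` matches, minus these charges (`exists_separated_le_excess`).

Conversely, fix a separated encoding. By unique decoding, a label of `u` has at most one near label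
at `v`, so a random permutation matches it with probability at most `1 / k`. The exponential moment
with parameter `L = log k / 2` has `exp L = √k`, so each encoded label on a random edge costs `e /
√k`; this is where `ε / √k` comes from. Choosing a word costs a factor `2 ^ d ≤ k ^ 77` in the union
bound, and the charge of 200 per word in `excess` pays `k ^ 100`. Hence some separated encoding has
nonnegative excess with probability at most `2⁻ⁿ` (`sum_separated_sum_exp_excess_le`), which
excludes solutions with `γ|E|` short random edges. -/

/-! ### Random hyperplane codes of vectors. -/

section SignCode

variable {E : Type*} [NormedAddCommGroup E] [InnerProductSpace ℝ E] [FiniteDimensional ℝ E]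
  [MeasurableSpace E] [BorelSpace E]

variable (E) in
/-- The uniform distribution on the unit ball. -/
noncomputable def unitBallMeasure : Measure E :=
  ProbabilityTheory.cond volume (Metric.ball (0 : E) 1)

instance : IsProbabilityMeasure (unitBallMeasure E) :=
  cond_isProbabilityMeasure_of_finite (Metric.measure_ball_pos volume _ one_pos).ne'
    measure_ball_lt_top.ne

/-- Invariance under isometries and null hyperplanes are all that the separation estimates use; no
angle is ever computed. -/
theorem unitBallMeasure_preimage (F : E ≃ₗᵢ[ℝ] E) (A : Set E) :
    unitBallMeasure E (F ⁻¹' A) = unitBallMeasure E A := by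
  unfold unitBallMeasure
  rw [cond_apply Metric.isOpen_ball.measurableSet, cond_apply Metric.isOpen_ball.measurableSet]
  congr 1
  have h : F ⁻¹' (Metric.ball (0 : E) 1 ∩ A) = Metric.ball 0 1 ∩ F ⁻¹' A := by
    rw [Set.preimage_inter]
    congr 1
    ext x
    simp
  rw [← h]
  exact F.measurePreserving.measure_preimage_emb F.toHomeomorph.measurableEmbedding _

theorem unitBallMeasure_hyperplane {v : E} (hv : v ≠ 0) :
    unitBallMeasure E {g | inner ℝ g v = 0} = 0 := by
  refine cond_absolutelyContinuous ?_
  have h : {g : E | inner ℝ g v = 0} = ((Submodule.span ℝ {v})ᗮ : Submodule ℝ E) := by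
    ext g
    simp [Submodule.mem_orthogonal_singleton_iff_inner_left]
  rw [h]
  refine Measure.addHaar_submodule _ _ fun h => ?_
  have : v ∈ (Submodule.span ℝ {v})ᗮ := h ▸ Submodule.mem_top
  rw [Submodule.mem_orthogonal_singleton_iff_inner_left] at this
  exact hv (inner_self_eq_zero.1 this)

omit [FiniteDimensional ℝ E] in
theorem measurableSet_inner_pos (v : E) : MeasurableSet {g : E | 0 < inner ℝ g v} :=
  (isOpen_lt continuous_const (by fun_prop)).measurableSet

/-- The vectors whose orthogonal hyperplane separates `v` from `w`. -/
def separatingSet (v w : E) : Set E := {g | ¬(0 < inner ℝ g v ↔ 0 < inner ℝ g w)}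

omit [FiniteDimensional ℝ E] in
theorem measurableSet_separatingSet (v w : E) : MeasurableSet (separatingSet v w) := by
  have : separatingSet v w = ({g : E | 0 < inner ℝ g v} \ {g : E | 0 < inner ℝ g w}) ∪
      ({g : E | 0 < inner ℝ g w} \ {g : E | 0 < inner ℝ g v}) := by
    ext g; simp only [separatingSet, Set.mem_ofPred_eq, Set.mem_union, Set.mem_sdiff]; tauto
  rw [this]
  exact ((measurableSet_inner_pos v).diff (measurableSet_inner_pos w)).union
    ((measurableSet_inner_pos w).diff (measurableSet_inner_pos v))

omit [FiniteDimensional ℝ E] [MeasurableSpace E] [BorelSpace E] in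
theorem separatingSet_comm (v w : E) : separatingSet v w = separatingSet w v := by
  ext g; simp only [separatingSet, Set.mem_ofPred_eq]; tauto

theorem unitBallMeasure_separatingSet_map (F : E ≃ₗᵢ[ℝ] E) (v w : E) :
    (unitBallMeasure E).real (separatingSet (F v) (F w)) =
      (unitBallMeasure E).real (separatingSet v w) := by
  rw [measureReal_def, measureReal_def, ← unitBallMeasure_preimage F (separatingSet (F v) (F w))]
  simp [separatingSet]

/-- Orthogonal vectors are separated with probability one half. -/
theorem unitBallMeasure_separatingSet_of_inner_eq_zero {v w : E} (hv : v ≠ 0)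
    (h : inner ℝ v w = 0) : (unitBallMeasure E).real (separatingSet v w) = 1 / 2 := by
  -- The reflection in the hyperplane orthogonal to `v` fixes `w` and negates `v`, which turns the
  -- separating set into its complement up to a null set.
  have h1 := unitBallMeasure_separatingSet_map (Submodule.span ℝ {v})ᗮ.reflection v w
  rw [Submodule.reflection_orthogonalComplement_singleton_eq_neg,
    Submodule.reflection_mem_subspace_eq_self
      ((Submodule.mem_orthogonal_singleton_iff_inner_right).2 h)] at h1
  have h2 : (unitBallMeasure E).real (separatingSet (-v) w) =
      (unitBallMeasure E).real (separatingSet v w)ᶜ := by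
    refine measureReal_congr ?_
    have h0 : ∀ᵐ g ∂unitBallMeasure E, inner ℝ g v ≠ 0 := by
      rw [ae_iff]; simpa using unitBallMeasure_hyperplane hv
    filter_upwards [h0] with g hg
    refine propext ?_
    change ¬(0 < inner ℝ g (-v) ↔ 0 < inner ℝ g w) ↔ ¬¬(0 < inner ℝ g v ↔ 0 < inner ℝ g w)
    have : 0 < inner ℝ g (-v) ↔ ¬ 0 < inner ℝ g v := by
      rw [inner_neg_right, not_lt]
      exact ⟨fun h => by linarith, fun h => by linarith [lt_of_le_of_ne h hg]⟩
    rw [this]; tauto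
  rw [h2, probReal_compl_eq_one_sub (measurableSet_separatingSet v w)] at h1
  linarith

/-- The reflection that exchanges `u` and `w` fixes `v`. -/
theorem unitBallMeasure_separatingSet_symm {u v w : E} (hn : ‖u‖ = ‖w‖)
    (hi : inner ℝ u v = inner ℝ v w) :
    (unitBallMeasure E).real (separatingSet v w) =
      (unitBallMeasure E).real (separatingSet u v) := by
  rw [← unitBallMeasure_separatingSet_map (Submodule.span ℝ {u - w})ᗮ.reflection u v,
    Submodule.reflection_sub hn, Submodule.reflection_mem_subspace_eq_self, separatingSet_comm]
  rw [Submodule.mem_orthogonal_singleton_iff_inner_right, inner_sub_left, hi, real_inner_comm w v,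
    sub_self]

/-- Consecutive terms are vectors in a plane at a fixed angle, of cosine `ρ`. -/
noncomputable def rotationSeq (ρ : ℝ) (u v : E) : ℕ → E
  | 0 => u
  | 1 => v
  | i + 2 => (2 * ρ) • rotationSeq ρ u v (i + 1) - rotationSeq ρ u v i

omit [FiniteDimensional ℝ E] [MeasurableSpace E] [BorelSpace E] in
theorem rotationSeq_spec {ρ : ℝ} {u v : E} (hu : ‖u‖ = 1) (hv : ‖v‖ = 1)
    (h : inner ℝ u v = ρ) (i : ℕ) :
    ‖rotationSeq ρ u v i‖ = 1 ∧ ‖rotationSeq ρ u v (i + 1)‖ = 1 ∧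
      inner ℝ (rotationSeq ρ u v i) (rotationSeq ρ u v (i + 1)) = ρ := by
  induction i with
  | zero => exact ⟨hu, hv, h⟩
  | succ i ih =>
    obtain ⟨h1, h2, h3⟩ := ih
    have h4 : rotationSeq ρ u v (i + 1 + 1) =
      (2 * ρ) • rotationSeq ρ u v (i + 1) - rotationSeq ρ u v i := rfl
    set a := rotationSeq ρ u v i
    set b := rotationSeq ρ u v (i + 1)
    refine ⟨h2, ?_, ?_⟩
    · have : ‖rotationSeq ρ u v (i + 1 + 1)‖ ^ 2 = 1 := by
        rw [h4, norm_sub_sq_real, norm_smul, mul_pow, h1, h2, inner_smul_left,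
          real_inner_comm, h3]
        simp only [conj_trivial, Real.norm_eq_abs, sq_abs]
        ring
      exact (pow_eq_one_iff_of_nonneg (norm_nonneg _) two_ne_zero).1 this
    · rw [h4, inner_sub_right, inner_smul_right, real_inner_self_eq_norm_sq, h2,
        real_inner_comm, h3]
      ring

theorem unitBallMeasure_separatingSet_rotationSeq {ρ : ℝ} {u v : E} (hu : ‖u‖ = 1)
    (hv : ‖v‖ = 1) (h : inner ℝ u v = ρ) (i : ℕ) :
    (unitBallMeasure E).real
      (separatingSet (rotationSeq ρ u v i) (rotationSeq ρ u v (i + 1))) =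
      (unitBallMeasure E).real (separatingSet u v) := by
  induction i with
  | zero => rfl
  | succ i ih =>
    rw [← ih]
    have h1 := rotationSeq_spec hu hv h i
    have h2 := rotationSeq_spec hu hv h (i + 1)
    exact unitBallMeasure_separatingSet_symm (h1.1.trans h2.2.1.symm) (h1.2.2.trans h2.2.2.symm)

/-- The coefficients are the Chebyshev values `U_j(ρ)` and `U_{j-1}(ρ)`. For `ρ = cos θ`, `U_j(ρ) =
sin ((j + 1) θ) / sin θ`, and `ρ ≥ 7 / 8 > cos (π / 6)` keeps `6 θ` below `π`. -/
theorem exists_coeff_of_linear_recurrence {ρ : ℝ} (hρ : 7 / 8 ≤ ρ) {s : ℕ → ℝ}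
    (hs : ∀ i, s (i + 2) = 2 * ρ * s (i + 1) - s i) (i : ℕ) {j : ℕ} (hj : j ≤ 5) :
    ∃ a b : ℝ, 0 < a ∧ 0 ≤ b ∧ s (i + 1 + j) = a * s (i + 1) - b * s i := by
  have e2 := hs i
  have e3 := hs (i + 1)
  have e4 := hs (i + 2)
  have e5 := hs (i + 3)
  have e6 := hs (i + 4)
  have hq : 49 / 64 ≤ ρ ^ 2 := by nlinarith
  have c2 : 0 < 4 * ρ ^ 2 - 1 := by linarith
  have c3 : 0 < 2 * ρ * (4 * ρ ^ 2 - 2) := by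
    have : 0 < 4 * ρ ^ 2 - 2 := by linarith
    positivity
  have c4 : 0 < 16 * ρ ^ 4 - 12 * ρ ^ 2 + 1 := by nlinarith
  have c5 : 0 < 2 * ρ * (4 * ρ ^ 2 - 1) * (4 * ρ ^ 2 - 3) := by
    have : 0 < 4 * ρ ^ 2 - 3 := by linarith
    positivity
  interval_cases j
  · exact ⟨1, 0, one_pos, le_rfl, by ring_nf⟩
  · refine ⟨2 * ρ, 1, by linarith, zero_le_one, ?_⟩
    change s (i + 2) = _; rw [e2]; ring
  · refine ⟨_, 2 * ρ, c2, by linarith, ?_⟩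
    change s (i + 3) = _; rw [e3, e2]; ring
  · refine ⟨_, _, c3, c2.le, ?_⟩
    change s (i + 4) = _; rw [e4, e3, e2]; ring
  · refine ⟨_, _, c4, c3.le, ?_⟩
    change s (i + 5) = _; rw [e5, e4, e3, e2]; ring
  · refine ⟨_, _, c5, c4.le, ?_⟩
    change s (i + 6) = _; rw [e6, e5, e4, e3, e2]; ring

/-- On a half turn the sign changes at most once. -/
theorem pos_iff_pos_of_linear_recurrence {ρ : ℝ} (hρ : 7 / 8 ≤ ρ) {s : ℕ → ℝ}
    (hs : ∀ i, s (i + 2) = 2 * ρ * s (i + 1) - s i) {i : ℕ}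
    (h : ¬(0 < s i ↔ 0 < s (i + 1))) {j : ℕ} (hj : j ≤ 5) :
    0 < s (i + 1) ↔ 0 < s (i + 1 + j) := by
  obtain ⟨a, b, ha, hb, e⟩ := exists_coeff_of_linear_recurrence hρ hs i hj
  rw [e]
  by_cases h1 : 0 < s (i + 1)
  · have h0 : s i ≤ 0 := by
      by_contra h0
      exact h ⟨fun _ => h1, fun _ => not_le.1 h0⟩
    refine iff_of_true h1 ?_
    nlinarith [mul_pos ha h1, mul_nonneg hb (neg_nonneg.2 h0)]
  · have h0 : 0 < s i := by
      by_contra h0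
      exact h (iff_of_false h0 h1)
    refine iff_of_false h1 ?_
    rw [not_lt] at h1 ⊢
    nlinarith [mul_nonneg ha.le (neg_nonneg.2 h1), mul_nonneg hb h0.le]

/-- Vectors at an angle whose cosine is at least `7 / 8` are rarely separated. -/
theorem unitBallMeasure_separatingSet_le_of_norm_eq_one {u v : E} (hu : ‖u‖ = 1)
    (hv : ‖v‖ = 1) (h : 7 / 8 ≤ inner ℝ u v) :
    (unitBallMeasure E).real (separatingSet u v) ≤ 1 / 6 := by
  set ρ := inner ℝ u v
  set A : ℕ → Set E := fun i =>
    separatingSet (rotationSeq ρ u v i) (rotationSeq ρ u v (i + 1))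
  have hrec (g : E) (i : ℕ) : inner ℝ g (rotationSeq ρ u v (i + 2)) =
      2 * ρ * inner ℝ g (rotationSeq ρ u v (i + 1)) - inner ℝ g (rotationSeq ρ u v i) := by
    rw [rotationSeq, inner_sub_right, inner_smul_right]
  -- Six rotations stay within a half turn, so a hyperplane separates at most one of the six
  -- consecutive pairs. These events are disjoint and equally likely, whence `1 / 6`.
  have hlt {i j : ℕ} (hij : i < j) (hj : j < 6) : Disjoint (A i) (A j) := by
    rw [Set.disjoint_left]
    intro g hi hj'
    have h1 := pos_iff_pos_of_linear_recurrence h (s := fun i => inner ℝ g (rotationSeq ρ u v i))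
      (hrec g) hi (j := j - (i + 1)) (by omega)
    have h2 := pos_iff_pos_of_linear_recurrence h (s := fun i => inner ℝ g (rotationSeq ρ u v i))
      (hrec g) hi (j := j - i) (by omega)
    rw [show i + 1 + (j - (i + 1)) = j by omega] at h1
    rw [show i + 1 + (j - i) = j + 1 by omega] at h2
    exact hj' (h1.symm.trans h2)
  have hd : (Finset.range 6 : Set ℕ).PairwiseDisjoint A := by
    intro i hi j hj hij
    rw [Finset.coe_range, Set.mem_Iio] at hi hj
    rcases lt_or_gt_of_ne hij with hij | hij
    · exact hlt hij hj
    · exact (hlt hij hi).symm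
  have h1 := measureReal_biUnion_finset (μ := unitBallMeasure E) hd
    fun i _ => measurableSet_separatingSet _ _
  have h2 : ∀ i, (unitBallMeasure E).real (A i) = (unitBallMeasure E).real (separatingSet u v) :=
    unitBallMeasure_separatingSet_rotationSeq hu hv rfl
  simp only [h2, Finset.sum_const, Finset.card_range, nsmul_eq_mul] at h1
  have h3 : (unitBallMeasure E).real (⋃ i ∈ Finset.range 6, A i) ≤ 1 := measureReal_le_one
  push_cast at h1
  linarith

theorem unitBallMeasure_separatingSet_le {u v : E} (hu : u ≠ 0) (hv : v ≠ 0)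
    (h : 7 / 8 * (‖u‖ * ‖v‖) ≤ inner ℝ u v) :
    (unitBallMeasure E).real (separatingSet u v) ≤ 1 / 6 := by
  have hu' := norm_pos_iff.2 hu
  have hv' := norm_pos_iff.2 hv
  have h1 : separatingSet u v = separatingSet (‖u‖⁻¹ • u) (‖v‖⁻¹ • v) := by
    ext g
    simp [separatingSet, inner_smul_right, hu', hv']
  rw [h1]
  refine unitBallMeasure_separatingSet_le_of_norm_eq_one
    (norm_smul_inv_norm hu) (norm_smul_inv_norm hv) ?_
  rw [inner_smul_left, inner_smul_right, conj_trivial, ← mul_assoc, ← mul_inv,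
    inv_mul_eq_div, le_div_iff₀ (by positivity)]
  exact h

open Classical in
/-- The signs of the inner products of `v` with the vectors `g l`. -/
noncomputable def signCode {d : ℕ} (g : Fin d → E) (v : E) : Fin d → Bool :=
  fun l => decide (0 < inner ℝ (g l) v)

variable (E) in
/-- The law of `d` independent uniform points of the unit ball. -/
noncomputable def unitBallPi (d : ℕ) : Measure (Fin d → E) :=
  Measure.pi fun _ => unitBallMeasure E

instance (d : ℕ) : IsProbabilityMeasure (unitBallPi E d) := by
  unfold unitBallPi; infer_instance

omit [FiniteDimensional ℝ E] [MeasurableSpace E] [BorelSpace E] in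
theorem signCode_ne_iff {d : ℕ} (g : Fin d → E) (v w : E) (l : Fin d) :
    signCode g v l ≠ signCode g w l ↔ g l ∈ separatingSet v w := by
  simp [signCode, separatingSet]

omit [FiniteDimensional ℝ E] [MeasurableSpace E] [BorelSpace E] in
theorem hammingDist_signCode {d : ℕ} (g : Fin d → E) (v w : E) :
    (hammingDist (signCode g v) (signCode g w) : ℝ) =
      ∑ l, (separatingSet v w).indicator 1 (g l) := by
  classical
  simp only [hammingDist, signCode_ne_iff, Set.indicator_apply, Pi.one_apply]
  rw [Finset.sum_boole]

omit [FiniteDimensional ℝ E] in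
theorem measurable_hammingDist_signCode {d : ℕ} (v w : E) :
    Measurable fun g : Fin d → E => (hammingDist (signCode g v) (signCode g w) : ℝ) := by
  simp only [hammingDist_signCode]
  exact Finset.measurable_sum _ fun l _ =>
    (measurable_one.indicator (measurableSet_separatingSet v w)).comp (measurable_pi_apply l)

omit [FiniteDimensional ℝ E] in
theorem measurableSet_hammingDist_signCode_le {d : ℕ} (v w : E) (r : ℕ) :
    MeasurableSet {g : Fin d → E | hammingDist (signCode g v) (signCode g w) ≤ r} := by
  have := measurable_hammingDist_signCode (d := d) v w (measurableSet_Iic (a := (r : ℝ)))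
  simpa [Set.preimage] using this

/-- The codes of vectors at a small angle are close with constant probability. -/
theorem signCode_close {ℓ : ℕ} (hℓ : 0 < ℓ) {u v : E} (hu : u ≠ 0) (hv : v ≠ 0)
    (h : 7 / 8 * (‖u‖ * ‖v‖) ≤ inner ℝ u v) :
    1 / 6 ≤ (unitBallPi E (70 * ℓ)).real
      {g | hammingDist (signCode g u) (signCode g v) ≤ 14 * ℓ} := by
  set μ := unitBallPi E (70 * ℓ)
  have hint (l : Fin (70 * ℓ)) :
      Integrable (fun g => (separatingSet u v).indicator (1 : E → ℝ) (g l)) μ := by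
    refine integrable_comp_eval (μ := fun _ => unitBallMeasure E) ?_
    exact (integrable_const 1).indicator (measurableSet_separatingSet u v)
  have h1 : ∫ g, (hammingDist (signCode g u) (signCode g v) : ℝ) ∂μ ≤ 70 * ℓ * (1 / 6) := by
    simp only [hammingDist_signCode]
    rw [integral_finsetSum _ fun l _ => hint l]
    have (l : Fin (70 * ℓ)) : ∫ g, (separatingSet u v).indicator (1 : E → ℝ) (g l) ∂μ ≤ 1 / 6 := by
      have := integral_comp_eval (μ := fun _ : Fin (70 * ℓ) => unitBallMeasure E) (i := l)
        (f := (separatingSet u v).indicator (1 : E → ℝ))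
        ((measurable_one.indicator (measurableSet_separatingSet u v)).aestronglyMeasurable)
      refine this.trans_le ?_
      rw [integral_indicator_one (measurableSet_separatingSet u v)]
      exact unitBallMeasure_separatingSet_le hu hv h
    refine (Finset.sum_le_sum fun l _ => this l).trans_eq ?_
    simp
  have hI : Integrable (fun g => (hammingDist (signCode g u) (signCode g v) : ℝ)) μ := by
    simp only [hammingDist_signCode]
    exact integrable_finsetSum _ fun l _ => hint l
  have h2 := mul_meas_ge_le_integral_of_nonneg (μ := μ)
    (Filter.Eventually.of_forall fun g => Nat.cast_nonneg _) hI (14 * ℓ)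
  have hpos : (0 : ℝ) < ℓ := by exact_mod_cast hℓ
  have h3 : {g : Fin (70 * ℓ) → E | hammingDist (signCode g u) (signCode g v) ≤ 14 * ℓ}ᶜ ⊆
      {g | (14 * ℓ : ℝ) ≤ (hammingDist (signCode g u) (signCode g v) : ℝ)} := by
    intro g hg
    simp only [Set.mem_compl_iff, Set.mem_ofPred_eq, not_le] at hg ⊢
    exact_mod_cast hg.le
  have h4 := measureReal_mono (μ := μ) h3
  rw [probReal_compl_eq_one_sub (measurableSet_hammingDist_signCode_le u v _)] at h4
  -- Markov: the mean is at most `70 * ℓ / 6`, and `(70 / 6) / 14 = 5 / 6`.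
  have h5 : μ.real {g | (14 * ℓ : ℝ) ≤ (hammingDist (signCode g u) (signCode g v) : ℝ)} ≤ 5 / 6 := by
    have := h2.trans h1
    nlinarith
  linarith

/-- The codes of orthogonal vectors are far apart with high probability. -/
theorem signCode_far (ℓ : ℕ) {v w : E} (hv : v ≠ 0) (h : inner ℝ v w = 0) :
    (unitBallPi E (70 * ℓ)).real
      {g | hammingDist (signCode g v) (signCode g w) ≤ 28 * ℓ} ≤ (1 / 4) ^ ℓ := by
  classical
  set μ := unitBallPi E (70 * ℓ)
  -- Chernoff bound with base `2 / 3`: `φ` is `2 / 3` on the separating set and 1 elsewhere, so its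
  -- mean is `5 / 6`. The constants 70 and 28 give `(5 / 6) ^ 70 * (3 / 2) ^ 28 ≤ 1 / 4`.
  set φ : E → ℝ := fun x => 1 - 1 / 3 * (separatingSet v w).indicator (1 : E → ℝ) x with hφ
  have hm : Integrable ((separatingSet v w).indicator (1 : E → ℝ)) (unitBallMeasure E) :=
    (integrable_const 1).indicator (measurableSet_separatingSet v w)
  have hφi : ∫ x, φ x ∂unitBallMeasure E = 5 / 6 := by
    rw [hφ, integral_sub (integrable_const _) (hm.const_mul _), integral_const_mul,
      integral_indicator_one (measurableSet_separatingSet v w),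
      unitBallMeasure_separatingSet_of_inner_eq_zero hv h]
    simp
    norm_num
  have hφm : Measurable φ := measurable_const.sub
    ((measurable_one.indicator (measurableSet_separatingSet v w)).const_mul _)
  have hprod (g : Fin (70 * ℓ) → E) :
      ∏ l, φ (g l) = (2 / 3 : ℝ) ^ hammingDist (signCode g v) (signCode g w) := by
    simp only [hammingDist, signCode_ne_iff]
    rw [← Finset.prod_const, Finset.prod_filter]
    refine Finset.prod_congr rfl fun l _ => ?_
    simp only [hφ, Set.indicator_apply, Pi.one_apply]
    split_ifs <;> norm_num
  have h1 : ∫ g, (2 / 3 : ℝ) ^ hammingDist (signCode g v) (signCode g w) ∂μ =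
      (5 / 6) ^ (70 * ℓ) := by
    simp only [← hprod]
    have := integral_fintype_prod_eq_prod (fun _ : Fin (70 * ℓ) => φ)
      (μ := fun _ => unitBallMeasure E)
    refine this.trans ?_
    simp only [hφi, Finset.prod_const, Finset.card_univ, Fintype.card_fin]
  have hI : Integrable
      (fun g => (2 / 3 : ℝ) ^ hammingDist (signCode g v) (signCode g w)) μ := by
    refine Integrable.of_bound (C := 1) ?_ (Filter.Eventually.of_forall fun g => ?_)
    · simp only [← hprod]
      exact (Finset.measurable_prod _ fun l _ =>
        hφm.comp (measurable_pi_apply l)).aestronglyMeasurable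
    · rw [Real.norm_of_nonneg (by positivity)]
      exact pow_le_one₀ (by norm_num) (by norm_num)
  have h2 := mul_meas_ge_le_integral_of_nonneg (μ := μ)
    (Filter.Eventually.of_forall fun g => by positivity) hI ((2 / 3) ^ (28 * ℓ))
  rw [h1] at h2
  have h3 : {g : Fin (70 * ℓ) → E | hammingDist (signCode g v) (signCode g w) ≤ 28 * ℓ} ⊆
      {g | (2 / 3 : ℝ) ^ (28 * ℓ) ≤ (2 / 3 : ℝ) ^ hammingDist (signCode g v) (signCode g w)} :=
    fun g hg =>
      pow_le_pow_of_le_one (a := (2 / 3 : ℝ)) (by norm_num) (by norm_num) hg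
  refine (measureReal_mono (μ := μ) h3).trans ?_
  have h4 : (0 : ℝ) < (2 / 3) ^ (28 * ℓ) := by positivity
  rw [← mul_le_mul_iff_right₀ h4]
  refine h2.trans ?_
  rw [pow_mul, pow_mul, ← mul_pow]
  exact pow_le_pow_left₀ (by norm_num) (by norm_num) _

end SignCode

/-! ### Agreements of a random permutation with a fixed map. -/

section Counting

/-- It makes `j` prescribed values of a random permutation hold with probability at most `(e / k) ^
j`, as if they were nearly independent. The induction rests on `(1 + 1 / k) ^ j ≤ e` for `j ≤ k`. -/
theorem pow_le_exp_one_pow_mul_descFactorial (k j : ℕ) (hj : j ≤ k) :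
    (k : ℝ) ^ j ≤ Real.exp 1 ^ j * k.descFactorial j := by
  induction k generalizing j with
  | zero => simp [Nat.le_zero.1 hj]
  | succ k ih =>
    rcases j with _ | j
    · simp
    have hj' : j ≤ k := by omega
    have h1 : ((k + 1 : ℕ) : ℝ) ^ j ≤ Real.exp 1 * (k : ℝ) ^ j := by
      rcases Nat.eq_zero_or_pos k with rfl | hk
      · obtain rfl : j = 0 := by omega
        simp
      have hk' : (0 : ℝ) < k := by exact_mod_cast hk
      have h2 : ((k + 1 : ℕ) : ℝ) = (1 + (k : ℝ)⁻¹) * k := by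
        push_cast; field_simp
      rw [h2, mul_pow]
      gcongr
      calc (1 + (k : ℝ)⁻¹) ^ j ≤ Real.exp ((k : ℝ)⁻¹) ^ j := by
            gcongr
            rw [add_comm]; exact Real.add_one_le_exp _
        _ = Real.exp (j * (k : ℝ)⁻¹) := (Real.exp_nat_mul _ _).symm
        _ ≤ Real.exp 1 := by
            gcongr
            rw [← div_eq_mul_inv, div_le_one hk']
            exact_mod_cast hj'
    rw [Nat.succ_descFactorial_succ, pow_succ, pow_succ]
    push_cast at h1 ⊢
    calc ((k : ℝ) + 1) ^ j * (k + 1) ≤ Real.exp 1 * (k : ℝ) ^ j * (k + 1) := by gcongr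
      _ ≤ Real.exp 1 * (Real.exp 1 ^ j * k.descFactorial j) * (k + 1) := by
          gcongr; exact ih j hj'
      _ = _ := by ring

open Finset in
/-- The number of permutations that agree with `τ` on `T`. -/
theorem card_perm_eqOn_le {k : ℕ} (τ : Fin k → Fin k) (T : Finset (Fin k)) :
    #{π : Equiv.Perm (Fin k) | ∀ i ∈ T, π i = τ i} ≤ (k - #T).factorial := by
  classical
  rcases Finset.eq_empty_or_nonempty
    ({π : Equiv.Perm (Fin k) | ∀ i ∈ T, π i = τ i} : Finset _) with h | ⟨π₀, h₀⟩
  · simp [h]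
  rw [mem_filter_univ] at h₀
  -- Left multiplication by `π₀⁻¹` maps these permutations into those that fix `T` pointwise.
  have h1 : #{π : Equiv.Perm (Fin k) | ∀ i ∈ T, π i = τ i} ≤
      #{π : Equiv.Perm (Fin k) | ∀ i, ¬(i ∉ T) → π i = i} := by
    refine card_le_card_of_injOn (fun π => π₀⁻¹ * π) (fun π hπ => ?_) fun π _ π' _ h => ?_
    · rw [mem_coe, mem_filter_univ] at hπ ⊢
      intro i hi
      rw [not_not] at hi
      rw [Equiv.Perm.mul_apply, hπ i hi, ← h₀ i hi]
      simp
    · exact mul_left_cancel h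
  refine h1.trans_eq ?_
  rw [← Fintype.card_subtype, ← Fintype.card_congr (Equiv.Perm.subtypeEquivSubtypePerm (· ∉ T)),
    Fintype.card_perm]
  congr 1
  rw [Fintype.card_subtype_compl]
  simp

open Finset in
/-- Exponential moment of the number of places of `D` at which a random permutation agrees
with `τ`. -/
theorem sum_perm_pow_card_le {k : ℕ} (τ : Fin k → Fin k) (D : Finset (Fin k)) {z : ℝ}
    (hz : 1 ≤ z) :
    ∑ π : Equiv.Perm (Fin k), z ^ #{i ∈ D | π i = τ i} ≤
      k.factorial * Real.exp (Real.exp 1 * z / k * #D) := by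
  classical
  rcases Nat.eq_zero_or_pos k with rfl | hk
  · have : D = ∅ := Finset.eq_empty_of_isEmpty D
    subst this
    simp
  have hk' : (0 : ℝ) < k := by exact_mod_cast hk
  -- Write each factor `z` as `1 + (z - 1)` and expand the product over the subsets `T` of agreeing
  -- places.
  have hexp (π : Equiv.Perm (Fin k)) : z ^ #{i ∈ D | π i = τ i} =
      ∑ T ∈ D.powerset, if ∀ i ∈ T, π i = τ i then (z - 1) ^ #T else 0 := by
    rw [← Finset.prod_const, Finset.prod_filter]
    have : ∀ i ∈ D, (if π i = τ i then z else 1) = 1 + if π i = τ i then z - 1 else 0 := by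
      intro i _; split_ifs <;> ring
    rw [Finset.prod_congr rfl this, Finset.prod_one_add]
    refine Finset.sum_congr rfl fun T _ => ?_
    rw [← Finset.prod_const]
    rw [Finset.prod_ite_zero]
    congr
  have hterm (T : Finset (Fin k)) :
      ∑ π : Equiv.Perm (Fin k), (if ∀ i ∈ T, π i = τ i then (z - 1) ^ #T else 0) ≤
        k.factorial * ∏ i ∈ T, (Real.exp 1 * (z - 1) / k) := by
    have hT : #T ≤ k := by simpa using card_le_univ T
    rw [← Finset.sum_filter, Finset.sum_const, nsmul_eq_mul, Finset.prod_const]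
    have h1 : (#{π : Equiv.Perm (Fin k) | ∀ i ∈ T, π i = τ i} : ℝ) ≤ (k - #T).factorial := by
      exact_mod_cast card_perm_eqOn_le τ T
    have h2 := pow_le_exp_one_pow_mul_descFactorial k _ hT
    have h3 : ((k - #T).factorial : ℝ) * k.descFactorial #T = k.factorial := by
      exact_mod_cast Nat.factorial_mul_descFactorial hT
    have h4 : ((k - #T).factorial : ℝ) ≤ k.factorial * (Real.exp 1 / k) ^ #T := by
      rw [div_pow, mul_div_assoc', le_div_iff₀ (by positivity), ← h3]
      calc _ ≤ ((k - #T).factorial : ℝ) * (Real.exp 1 ^ #T * k.descFactorial #T) := by gcongr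
        _ = _ := by ring
    have h5 : 0 ≤ (z - 1) ^ #T := pow_nonneg (by linarith) _
    calc _ ≤ ((k - #T).factorial : ℝ) * (z - 1) ^ #T := by gcongr
      _ ≤ k.factorial * (Real.exp 1 / k) ^ #T * (z - 1) ^ #T := by gcongr
      _ = _ := by rw [mul_assoc, ← mul_pow, div_mul_eq_mul_div]
  calc ∑ π : Equiv.Perm (Fin k), z ^ #{i ∈ D | π i = τ i}
      = ∑ T ∈ D.powerset, ∑ π : Equiv.Perm (Fin k),
          (if ∀ i ∈ T, π i = τ i then (z - 1) ^ #T else 0) := by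
        rw [Finset.sum_comm]; exact Finset.sum_congr rfl fun π _ => hexp π
    _ ≤ ∑ T ∈ D.powerset, k.factorial * ∏ i ∈ T, (Real.exp 1 * (z - 1) / k) :=
        Finset.sum_le_sum fun T _ => hterm T
    _ = k.factorial * (1 + Real.exp 1 * (z - 1) / k) ^ #D := by
        rw [← Finset.mul_sum, ← Finset.prod_one_add, Finset.prod_const]
    _ ≤ _ := by
        have h1 : 1 + Real.exp 1 * (z - 1) / k ≤ Real.exp (Real.exp 1 * z / k) := by
          refine le_trans ?_ (Real.add_one_le_exp _)
          rw [add_comm]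
          gcongr
          linarith
        have h0 : 0 ≤ Real.exp 1 * (z - 1) / k := by
          have : 0 ≤ z - 1 := by linarith
          positivity
        rw [mul_comm (Real.exp 1 * z / k), Real.exp_nat_mul]
        gcongr

end Counting

/-! ### Partial encodings and their matches with random constraints. -/

section Encoding

variable {V : Type*} {k d : ℕ}

/-- A partial encoding assigns binary words to some pairs of a vertex and a label. -/
abbrev PartialEncoding (V : Type*) (k d : ℕ) := V × Fin k → Option (Fin d → Bool)

namespace PartialEncoding

/-- The words of `(u, i)` and `(v, j)` are defined and differ in at most `r` places. -/
def Near (f : PartialEncoding V k d) (r : ℕ) (p q : V × Fin k) : Prop :=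
  ∃ a b, f p = some a ∧ f q = some b ∧ hammingDist a b ≤ r

/-- The words of distinct labels of a vertex differ in more than `r` places. -/
def Separated (f : PartialEncoding V k d) (r : ℕ) : Prop :=
  ∀ u i j a b, i ≠ j → f (u, i) = some a → f (u, j) = some b → r < hammingDist a b

/-- The labels of `u` that have a word. -/
def labels (f : PartialEncoding V k d) (u : V) : Finset (Fin k) :=
  {i | (f (u, i)).isSome}

/-- Unique decoding: two words within `r` of a third are within `2 * r` of each other. -/
theorem Near.eq {f : PartialEncoding V k d} {r : ℕ} (hf : f.Separated (2 * r))
    {p : V × Fin k} {v : V} {j j' : Fin k} (h : f.Near r p (v, j)) (h' : f.Near r p (v, j')) :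
    j = j' := by
  obtain ⟨a, b, ha, hb, hab⟩ := h
  obtain ⟨a', b', ha', hb', hab'⟩ := h'
  obtain rfl : a = a' := Option.some_injective _ (ha.symm.trans ha')
  by_contra hne
  have h1 := hf v j j' b b' hne hb hb'
  have h2 := hammingDist_triangle b a b'
  rw [hammingDist_comm b a] at h2
  omega

open Finset Classical in
theorem sum_perm_pow_card_near_le {f : PartialEncoding V k d} {r : ℕ}
    (hf : f.Separated (2 * r)) (u v : V) {z : ℝ} (hz : 1 ≤ z) :
    ∑ π : Equiv.Perm (Fin k), z ^ #{i | f.Near r (u, i) (v, π i)} ≤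
      k.factorial * Real.exp (Real.exp 1 * z / k * #(f.labels u)) := by
  have hτ : ∀ i, ∃ j, ∀ j', f.Near r (u, i) (v, j') → j' = j := by
    intro i
    by_cases h : ∃ j, f.Near r (u, i) (v, j)
    · obtain ⟨j, hj⟩ := h
      exact ⟨j, fun j' hj' => hj'.eq hf hj⟩
    -- With no near label, any value of `τ` will do.
    · exact ⟨i, fun j' hj' => absurd ⟨j', hj'⟩ h⟩
  choose τ hτ using hτ
  refine le_trans (Finset.sum_le_sum fun π _ => ?_) (sum_perm_pow_card_le τ (f.labels u) hz)
  refine pow_le_pow_right₀ hz (card_le_card fun i hi => ?_)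
  rw [mem_filter_univ] at hi
  rw [mem_filter]
  refine ⟨?_, hτ i _ hi⟩
  obtain ⟨a, b, ha, -⟩ := hi
  simp [labels, ha]

open Finset Classical in
/-- The number of places at which the constraints `ρ` match the encoding. -/
noncomputable def matchCount {ι : Type*} [Fintype ι] (f : PartialEncoding V k d) (r : ℕ)
    (s t : ι → V) (ρ : ι → Equiv.Perm (Fin k)) : ℕ :=
  ∑ e, #{i | f.Near r (s e, i) (t e, ρ e i)}

-- The permutations on different edges are independent, so the moment factors over the edges.
open Finset in
theorem sum_exp_matchCount_le {ι : Type*} [Fintype ι] [DecidableEq ι] {f : PartialEncoding V k d}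
    {r : ℕ} (hf : f.Separated (2 * r)) (s t : ι → V) {L : ℝ} (hL : 0 ≤ L) :
    ∑ ρ : ι → Equiv.Perm (Fin k), Real.exp (L * f.matchCount r s t ρ) ≤
      (k.factorial : ℝ) ^ Fintype.card ι *
        Real.exp (Real.exp 1 * Real.exp L / k * ∑ e, (#(f.labels (s e)) : ℝ)) := by
  classical
  have h1 (ρ : ι → Equiv.Perm (Fin k)) : Real.exp (L * f.matchCount r s t ρ) =
      ∏ e, Real.exp L ^ #{i | f.Near r (s e, i) (t e, ρ e i)} := by
    rw [Finset.prod_pow_eq_pow_sum, ← Real.exp_nat_mul, mul_comm]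
    rfl
  simp only [h1]
  rw [← Fintype.piFinset_univ, ← Finset.prod_univ_sum (fun _ => univ)
    (fun e (π : Equiv.Perm (Fin k)) => Real.exp L ^ #{i | f.Near r (s e, i) (t e, π i)})]
  refine (Finset.prod_le_prod (fun e _ => by positivity) fun e _ =>
    sum_perm_pow_card_near_le hf (s e) (t e) (Real.one_le_exp hL)).trans_eq ?_
  rw [Finset.prod_mul_distrib, Finset.mul_sum, Real.exp_sum]
  simp

-- The weight factors over pairs of a vertex and a label: a missing word contributes 1, each of the
-- `2 ^ d` words contributes `exp (-c)`.
open Finset in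
theorem sum_exp_card_labels [Fintype V] [DecidableEq V] (c : ℝ) :
    ∑ f : PartialEncoding V k d, Real.exp (-c * ∑ u, (#(f.labels u) : ℝ)) =
      (1 + 2 ^ d * Real.exp (-c)) ^ (Fintype.card V * k) := by
  have h1 (f : PartialEncoding V k d) : Real.exp (-c * ∑ u, (#(f.labels u) : ℝ)) =
      ∏ p, if (f p).isSome then Real.exp (-c) else 1 := by
    rw [Fintype.prod_prod_type, Finset.mul_sum, Real.exp_sum]
    refine Finset.prod_congr rfl fun u _ => ?_
    rw [← Finset.prod_filter, Finset.prod_const, mul_comm, Real.exp_nat_mul]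
    rfl
  simp only [h1]
  rw [← Fintype.piFinset_univ, ← Finset.prod_univ_sum (fun _ => univ)
    (fun (_ : V × Fin k) (a : Option (Fin d → Bool)) => if a.isSome then Real.exp (-c) else 1)]
  rw [Finset.prod_const, Fintype.sum_option]
  simp

/-! ### The union bound over encodings. -/

theorem two_pow_clog_le {k : ℕ} (hk : 2 ≤ k) : 2 ^ Nat.clog 2 k ≤ 2 * k := by
  have h1 := Nat.pow_pred_clog_lt_self (b := 2) (by norm_num) (x := k) (by omega)
  have h2 : 0 < Nat.clog 2 k := Nat.clog_pos (by norm_num) hk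
  obtain ⟨m, hm⟩ : ∃ m, Nat.clog 2 k = m + 1 := ⟨_, (Nat.succ_pred_eq_of_pos h2).symm⟩
  rw [hm] at h1 ⊢
  rw [Nat.pred_succ] at h1
  rw [pow_succ]
  omega

theorem two_pow_seventy_mul_clog_le {k : ℕ} (hk : 1024 ≤ k) :
    (2 : ℝ) ^ (70 * Nat.clog 2 k) ≤ (k : ℝ) ^ 77 := by
  have hkR : (1024 : ℝ) ≤ k := by exact_mod_cast hk
  have h1 : (2 : ℝ) ^ Nat.clog 2 k ≤ 2 * k := by
    exact_mod_cast two_pow_clog_le (by omega)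
  calc (2 : ℝ) ^ (70 * Nat.clog 2 k) = (2 ^ Nat.clog 2 k) ^ 70 := by rw [← pow_mul, mul_comm]
    _ ≤ (2 * k) ^ 70 := by gcongr
    _ = 1024 ^ 7 * (k : ℝ) ^ 70 := by rw [mul_pow]; norm_num
    _ ≤ (k : ℝ) ^ 7 * (k : ℝ) ^ 70 := by gcongr
    _ = _ := by rw [← pow_add]

/-- The number of matches, minus the number that an encoding of this size can have by chance. -/
noncomputable def excess {ι : Type*} [Fintype ι] [Fintype V] (f : PartialEncoding V k d) (r : ℕ)
    (s t : ι → V) (ρ : ι → Equiv.Perm (Fin k)) : ℝ :=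
  f.matchCount r s t ρ - 200 * (∑ u, ((f.labels u).card : ℝ) + Fintype.card V) -
    (∑ e, ((f.labels (s e)).card : ℝ)) / Real.sqrt k

theorem exp_one_le_half_log {k : ℕ} (hk : 1024 ≤ k) : Real.exp 1 ≤ Real.log k / 2 := by
  have hkR : (1024 : ℝ) ≤ k := by exact_mod_cast hk
  have hlog : 10 * Real.log 2 ≤ Real.log k := by
    rw [← Real.log_rpow (by norm_num)]
    exact Real.log_le_log (by positivity) (by norm_num; linarith)
  have := Real.exp_one_lt_d9
  have := Real.log_two_gt_d9
  linarith

/-- With `L = log k / 2` the moment bound is `exp (e * P / √k)`, where `P` counts encoded labels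
over the edges. The last term of `excess` contributes `exp (-L * P / √k)`, which cancels it because
`e ≤ L`. -/
theorem sum_exp_excess_le {ι : Type*} [Fintype ι] [DecidableEq ι] [Fintype V]
    (hk : 1024 ≤ k) (s t : ι → V) {r : ℕ} {f : PartialEncoding V k d}
    (hf : f.Separated (2 * r)) :
    ∑ ρ : ι → Equiv.Perm (Fin k), Real.exp (Real.log k / 2 * f.excess r s t ρ) ≤
      (k.factorial : ℝ) ^ Fintype.card ι * (Real.exp (-(100 * Real.log k) * Fintype.card V) *
        Real.exp (-(100 * Real.log k) * ∑ u, ((f.labels u).card : ℝ))) := by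
  have hk0 : (0 : ℝ) < k := by exact_mod_cast (by omega : 0 < k)
  have hsq : 0 < Real.sqrt k := Real.sqrt_pos.2 hk0
  have hL := exp_one_le_half_log hk
  have hM := sum_exp_matchCount_le hf s t ((Real.exp_pos 1).le.trans hL)
  rw [Real.exp_half, Real.exp_log hk0] at hM
  unfold excess
  set N := ∑ u, ((f.labels u).card : ℝ)
  set P := ∑ e, ((f.labels (s e)).card : ℝ)
  have hP : 0 ≤ P := Finset.sum_nonneg fun _ _ => Nat.cast_nonneg _
  clear_value N P
  have h1 (ρ : ι → Equiv.Perm (Fin k)) :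
      Real.exp (Real.log k / 2 * (f.matchCount r s t ρ - 200 * (N + Fintype.card V) -
        P / Real.sqrt k)) = Real.exp (Real.log k / 2 * f.matchCount r s t ρ) *
        (Real.exp (-(100 * Real.log k) * Fintype.card V) * Real.exp (-(100 * Real.log k) * N) *
          Real.exp (-(Real.log k / 2 * (P / Real.sqrt k)))) := by
    rw [← Real.exp_add, ← Real.exp_add, ← Real.exp_add]
    congr 1; ring
  rw [Finset.sum_congr rfl fun ρ _ => h1 ρ, ← Finset.sum_mul]
  refine (mul_le_mul_of_nonneg_right hM (by positivity)).trans ?_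
  have h2 : Real.exp (Real.exp 1 * Real.sqrt k / k * P) *
      Real.exp (-(Real.log k / 2 * (P / Real.sqrt k))) ≤ 1 := by
    rw [← Real.exp_add, Real.exp_le_one_iff, mul_div_assoc, Real.sqrt_div_self']
    have h3 : 0 ≤ P / Real.sqrt k := div_nonneg hP hsq.le
    have h4 := mul_le_mul_of_nonneg_right hL h3
    have h5 : Real.exp 1 * (1 / Real.sqrt k) * P = Real.exp 1 * (P / Real.sqrt k) := by ring
    linarith
  refine le_trans (le_of_eq ?_) (mul_le_of_le_one_right (by positivity) h2)
  ring

theorem exp_neg_hundred_log {k : ℕ} (hk : 0 < k) :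
    Real.exp (-(100 * Real.log k)) = ((k : ℝ) ^ 100)⁻¹ := by
  have hk0 : (0 : ℝ) < k := by exact_mod_cast hk
  rw [Real.exp_neg, show 100 * Real.log k = ((100 : ℕ) : ℝ) * Real.log k by push_cast; ring,
    Real.exp_nat_mul, Real.exp_log hk0]

open Classical in
/-- The union bound over all separated encodings. -/
theorem sum_separated_sum_exp_excess_le {ι : Type*} [Fintype ι] [Fintype V]
    (hk : 1024 ≤ k) (hd : (2 : ℝ) ^ d ≤ (k : ℝ) ^ 77) (s t : ι → V) (r : ℕ) :
    ∑ ρ : ι → Equiv.Perm (Fin k), ∑ f : PartialEncoding V k d with f.Separated (2 * r),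
      Real.exp (Real.log k / 2 * f.excess r s t ρ) ≤
      (k.factorial : ℝ) ^ Fintype.card ι * (1 / 2) ^ Fintype.card V := by
  have hkR : (1024 : ℝ) ≤ k := by exact_mod_cast hk
  have hk0 : (0 : ℝ) < k := by linarith
  rw [Finset.sum_comm]
  refine (Finset.sum_le_sum fun f hf =>
    sum_exp_excess_le hk s t (Finset.mem_filter.1 hf).2).trans ?_
  rw [← Finset.mul_sum, ← Finset.mul_sum]
  refine mul_le_mul_of_nonneg_left ?_ (by positivity)
  have hsum : ∑ f : PartialEncoding V k d with f.Separated (2 * r),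
      Real.exp (-(100 * Real.log k) * ∑ u, ((f.labels u).card : ℝ)) ≤
        (1 + 2 ^ d * Real.exp (-(100 * Real.log k))) ^ (Fintype.card V * k) := by
    rw [← sum_exp_card_labels]
    exact Finset.sum_le_sum_of_subset_of_nonneg (Finset.filter_subset _ _)
      fun _ _ _ => (Real.exp_pos _).le
  generalize Fintype.card V = n at *
  have hexp := exp_neg_hundred_log (k := k) (by omega)
  -- All possible words of one vertex together contribute at most `e`, since each label adds at most
  -- `1 / k`.
  have h1 : (1 + 2 ^ d * Real.exp (-(100 * Real.log k))) ^ k ≤ Real.exp 1 := by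
    have h2 : 2 ^ d * Real.exp (-(100 * Real.log k)) ≤ (k : ℝ)⁻¹ := by
      rw [hexp, ← div_eq_mul_inv, div_le_iff₀ (by positivity)]
      refine hd.trans ?_
      rw [inv_mul_eq_div, le_div_iff₀ hk0, ← pow_succ]
      exact pow_le_pow_right₀ (by linarith) (by norm_num)
    calc _ ≤ Real.exp (k : ℝ)⁻¹ ^ k := by
          refine pow_le_pow_left₀ (by positivity) ?_ _
          refine le_trans ?_ (Real.add_one_le_exp _)
          linarith
      _ = Real.exp 1 := by
          rw [← Real.exp_nat_mul, mul_inv_cancel₀ hk0.ne']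
  have h3 : Real.exp (-(100 * Real.log k)) * Real.exp 1 ≤ 1 / 2 := by
    rw [hexp, inv_mul_le_iff₀ (by positivity)]
    have := Real.exp_one_lt_d9
    have : (k : ℝ) ≤ (k : ℝ) ^ 100 := le_self_pow₀ (by linarith) (by norm_num)
    linarith
  refine (mul_le_mul_of_nonneg_left hsum (Real.exp_pos _).le).trans ?_
  calc Real.exp (-(100 * Real.log k) * n) *
        (1 + 2 ^ d * Real.exp (-(100 * Real.log k))) ^ (n * k)
      = (Real.exp (-(100 * Real.log k)) *
          (1 + 2 ^ d * Real.exp (-(100 * Real.log k))) ^ k) ^ n := by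
        rw [mul_comm _ (n : ℝ), Real.exp_nat_mul, mul_comm n k, pow_mul, mul_pow]
    _ ≤ (Real.exp (-(100 * Real.log k)) * Real.exp 1) ^ n := by gcongr
    _ ≤ _ := by gcongr

end PartialEncoding

end Encoding

/-! ### Random instances as independent permutations. -/

namespace UniqueGame

variable {V : Type*} {G : SimpleGraph V} {k : ℕ}

theorem exists_dart_of_subset_edgeSet {S : Set (Sym2 V)} (hS : S ⊆ G.edgeSet) :
    ∃ δ : S → G.Dart, ∀ e, (δ e).edge = e := by
  have h : ∀ e : S, ∃ x : G.Dart, x.edge = e := by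
    rintro ⟨e, he⟩
    induction e using Sym2.ind with
    | _ u v => exact ⟨⟨(u, v), hS he⟩, rfl⟩
  exact Classical.skolem.1 h

/-- One chosen dart per edge carries the free permutation, and the opposite dart its inverse. Thus
the uniform law on corruptions is that of independent uniform permutations. -/
theorem corruptions_bijective (I : UniqueGame G k) {S : Set (Sym2 V)} (δ : S → G.Dart)
    (hδ : ∀ e, (δ e).edge = e) :
    Function.Bijective fun (J : I.corruptions S) (e : S) => J.1.perm (δ e) := by
  classical
  have hcase (x : G.Dart) (h : x.edge ∈ S) : x = δ ⟨_, h⟩ ∨ x = (δ ⟨_, h⟩).symm :=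
    (SimpleGraph.dart_edge_eq_iff _ _).1 (hδ ⟨_, h⟩).symm
  constructor
  · rintro ⟨J, hJ⟩ ⟨J', hJ'⟩ h
    refine Subtype.ext (UniqueGame.ext (funext fun x => ?_))
    by_cases hx : x.edge ∈ S
    · have h1 : J.perm (δ ⟨_, hx⟩) = J'.perm (δ ⟨_, hx⟩) := congrFun h ⟨_, hx⟩
      rcases hcase x hx with h2 | h2
      · rw [h2]; exact h1
      · rw [h2, J.perm_symm, J'.perm_symm, h1]
    · exact (hJ x hx).trans (hJ' x hx).symm
  · intro ρ
    refine ⟨⟨⟨fun x => if h : x.edge ∈ S then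
      (if x = δ ⟨_, h⟩ then ρ ⟨_, h⟩ else (ρ ⟨_, h⟩)⁻¹) else I.perm x, fun x => ?_⟩,
      fun x hx => dif_neg hx⟩, funext fun e => ?_⟩
    · by_cases h : x.edge ∈ S
      · have h' : x.symm.edge ∈ S := by rwa [SimpleGraph.Dart.edge_symm]
        have he : (⟨_, h'⟩ : S) = ⟨_, h⟩ := Subtype.ext (SimpleGraph.Dart.edge_symm x)
        rw [dif_pos h, dif_pos h', he]
        rcases hcase x h with h2 | h2
        · rw [if_pos h2, if_neg]
          rw [← h2]
          exact SimpleGraph.Dart.symm_ne x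
        · have h3 : x.symm = δ ⟨_, h⟩ := by
            conv_lhs => rw [h2]
            exact SimpleGraph.Dart.symm_symm _
          rw [if_pos h3, if_neg, inv_inv]
          rw [← h3]
          exact (SimpleGraph.Dart.symm_ne x).symm
      · have h' : x.symm.edge ∉ S := by rwa [SimpleGraph.Dart.edge_symm]
        rw [dif_neg h, dif_neg h', I.perm_symm]
    · have h : (δ e).edge ∈ S := by rw [hδ]; exact e.2
      have he : (⟨_, h⟩ : S) = e := Subtype.ext (hδ e)
      change (if h : (δ e).edge ∈ S then
        (if δ e = δ ⟨_, h⟩ then ρ ⟨_, h⟩ else (ρ ⟨_, h⟩)⁻¹) else I.perm (δ e)) = ρ e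
      rw [dif_pos h, he, if_pos rfl]

/-- Markov's inequality for the random constraints. -/
theorem randomCorruption_real_le [Finite V] (I : UniqueGame G k) {S : Set (Sym2 V)} [Fintype S]
    [DecidableEq S] (δ : S → G.Dart) (hδ : ∀ e, (δ e).edge = e) (A : Set (UniqueGame G k))
    (Φ : (S → Equiv.Perm (Fin k)) → ℝ) (h0 : ∀ ρ, 0 ≤ Φ ρ)
    (hA : ∀ J ∈ A, 1 ≤ Φ fun e => J.perm (δ e)) {b : ℝ}
    (hb : ∑ ρ, Φ ρ ≤ (k.factorial : ℝ) ^ Fintype.card S * b) :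
    (I.randomCorruption S).real A ≤ b := by
  classical
  have := Fintype.ofFinite (UniqueGame G k)
  have hbij := I.corruptions_bijective δ hδ
  have hcard : (I.corruptions S).toFinset.card = k.factorial ^ Fintype.card S := by
    rw [Set.toFinset_card, Fintype.card_of_bijective hbij]
    simp [Fintype.card_perm]
  have h1 : I.randomCorruption S A = ((I.corruptions S).toFinset ∩ A.toFinset).card /
      (I.corruptions S).toFinset.card := by
    rw [← uniformOn_apply_finset]
    simp [randomCorruption]
  rw [measureReal_def, h1, ENNReal.toReal_div, ENNReal.toReal_natCast, ENNReal.toReal_natCast,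
    hcard, div_le_iff₀ (by positivity), mul_comm b]
  push_cast
  refine le_trans ?_ hb
  set T := (I.corruptions S).toFinset ∩ A.toFinset
  have hinj : Set.InjOn (fun (J : UniqueGame G k) (e : S) => J.perm (δ e)) T := by
    intro J hJ J' hJ' h
    have hm : J ∈ I.corruptions S := by
      have := (Finset.mem_inter.1 (Finset.mem_coe.1 hJ)).1; simpa using this
    have hm' : J' ∈ I.corruptions S := by
      have := (Finset.mem_inter.1 (Finset.mem_coe.1 hJ')).1; simpa using this
    exact congrArg Subtype.val (hbij.1 (a₁ := ⟨J, hm⟩) (a₂ := ⟨J', hm'⟩) h)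
  calc (T.card : ℝ) = ∑ J ∈ T, 1 := by simp
    _ ≤ ∑ J ∈ T, Φ fun e => J.perm (δ e) := by
        refine Finset.sum_le_sum fun J hJ => hA J ?_
        have := (Finset.mem_inter.1 hJ).2; simpa using this
    _ = ∑ ρ ∈ T.image fun J e => J.perm (δ e), Φ ρ := by rw [Finset.sum_image hinj]
    _ ≤ ∑ ρ, Φ ρ := Finset.sum_le_sum_of_subset_of_nonneg (Finset.subset_univ _) fun ρ _ _ => h0 ρ

end UniqueGame

/-! ### From a solution to an encoding. -/

section Rounding

/-- Some point of a probability space is in at least the expected weight of the events. -/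
theorem exists_le_sum_indicator {Ω ι : Type*} [MeasurableSpace Ω] [Fintype ι] (μ : Measure Ω)
    [IsProbabilityMeasure μ] (w : ι → ℝ) (A : ι → Set Ω) (hA : ∀ i, MeasurableSet (A i)) :
    ∃ ω, ∑ i, w i * μ.real (A i) ≤ ∑ i, w i * (A i).indicator 1 ω := by
  have hint (i : ι) : Integrable (fun ω => w i * (A i).indicator (1 : Ω → ℝ) ω) μ :=
    ((integrable_const 1).indicator (hA i)).const_mul _
  obtain ⟨ω, hω⟩ := exists_integral_le (μ := μ) (integrable_finsetSum Finset.univ fun i _ => hint i)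
  refine ⟨ω, le_trans (le_of_eq ?_) hω⟩
  rw [integral_finsetSum _ fun i _ => hint i]
  refine Finset.sum_congr rfl fun i _ => ?_
  rw [integral_const_mul, integral_indicator_one (hA i)]

/-- Some threshold in `[0, 1)` does as well as a uniformly random one. -/
theorem exists_threshold {ι : Type*} [Fintype ι] (c a : ι → ℝ) (h0 : ∀ i, 0 ≤ a i)
    (h1 : ∀ i, a i ≤ 1) :
    ∃ t : ℝ, 0 ≤ t ∧ ∑ i, c i * a i ≤ ∑ i, c i * (Set.Ioi t).indicator 1 (a i) := by
  obtain ⟨t, ht⟩ := exists_le_sum_indicator (volume : Measure unitInterval) c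
    (fun i => {t | (t : ℝ) < a i}) fun i => measurableSet_lt measurable_subtype_coe measurable_const
  refine ⟨t, t.2.1, ?_⟩
  have hv (i : ι) : (volume : Measure unitInterval).real {t | (t : ℝ) < a i} = a i := by
    have : {t : unitInterval | (t : ℝ) < a i} = Set.Iio ⟨a i, h0 i, h1 i⟩ := by
      ext t; exact Iff.rfl
    rw [this, measureReal_def, unitInterval.volume_Iio]
    exact ENNReal.toReal_ofReal (h0 i)
  simpa [hv, Set.indicator_apply] using ht

variable {E : Type*} [NormedAddCommGroup E] [InnerProductSpace ℝ E]

/-- The vectors are nonzero and the cosine of their angle is at least `7 / 8`. -/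
def SmallAngle (x y : E) : Prop := x ≠ 0 ∧ y ≠ 0 ∧ 7 / 8 * (‖x‖ * ‖y‖) ≤ inner ℝ x y

-- At a large angle `‖x - y‖²` is at least `(‖x‖² + ‖y‖²) / 8`, so the left side is at most 0. At a
-- small angle `‖x - y‖ ≥ |‖x‖ - ‖y‖|` suffices, by completing squares.
open Classical in
theorem le_min_norm_sq_of_smallAngle (x y : E) :
    (‖x‖ ^ 2 + ‖y‖ ^ 2) / 4 - 2 * ‖x - y‖ ^ 2 ≤
      if SmallAngle x y then min (‖x‖ ^ 2) (‖y‖ ^ 2) else 0 := by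
  have hx := norm_nonneg x
  have hy := norm_nonneg y
  have hs := norm_sub_sq_real x y
  split_ifs with h
  · have hi := real_inner_le_norm x y
    rw [le_min_iff]
    constructor <;> nlinarith [sq_nonneg (‖x‖ - ‖y‖), sq_nonneg (3 * ‖x‖ - 2 * ‖y‖),
      sq_nonneg (2 * ‖x‖ - 3 * ‖y‖), sq_nonneg (11 * ‖x‖ - 8 * ‖y‖),
      sq_nonneg (8 * ‖x‖ - 11 * ‖y‖)]
  · have hi : inner ℝ x y ≤ 7 / 8 * (‖x‖ * ‖y‖) := by
      by_contra hc
      refine h ⟨?_, ?_, (not_le.1 hc).le⟩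
      · rintro rfl; simp at hc
      · rintro rfl; simp at hc
    nlinarith [sq_nonneg (‖x‖ - ‖y‖)]

variable [FiniteDimensional ℝ E] [MeasurableSpace E] [BorelSpace E]
variable {V : Type*} {k : ℕ}

/-- The code of the vector of `(u, i)` is at distance more than `r` from the codes of the other
nonzero vectors of `u`. -/
def Isolated {d : ℕ} (g : Fin d → E) (x : V → Fin k → E) (r : ℕ) (u : V) (i : Fin k) : Prop :=
  ∀ j, j ≠ i → x u j ≠ 0 → r < hammingDist (signCode g (x u i)) (signCode g (x u j))

omit [FiniteDimensional ℝ E] in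
theorem measurableSet_isolated {d : ℕ} (x : V → Fin k → E) (r : ℕ) (u : V) (i : Fin k) :
    MeasurableSet {g : Fin d → E | Isolated g x r u i} := by
  simp only [Isolated, Set.ofPred_forall]
  refine MeasurableSet.iInter fun j => MeasurableSet.iInter fun _ => MeasurableSet.iInter fun _ => ?_
  have := (measurableSet_hammingDist_signCode_le (d := d) (x u i) (x u j) r).compl
  simpa [Set.compl_ofPred] using this

/-- Union bound over the other labels, with `(1 / 4) ^ ℓ ≤ k⁻²` because `2 ^ ℓ ≥ k`. -/
theorem isolated_compl_le {x : V → Fin k → E} (u : V)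
    (hx : ∀ i j, i ≠ j → inner ℝ (x u i) (x u j) = 0) (i : Fin k) (hi : x u i ≠ 0) :
    (unitBallPi E (70 * Nat.clog 2 k)).real {g | Isolated g x (28 * Nat.clog 2 k) u i}ᶜ ≤
      1 / k := by
  classical
  set ℓ := Nat.clog 2 k
  have hk : 0 < k := i.pos
  have hk0 : (0 : ℝ) < k := by exact_mod_cast hk
  have hsub : {g : Fin (70 * ℓ) → E | Isolated g x (28 * ℓ) u i}ᶜ ⊆
      ⋃ j ∈ Finset.univ.erase i,
        {g | hammingDist (signCode g (x u i)) (signCode g (x u j)) ≤ 28 * ℓ} := by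
    intro g hg
    simp only [Set.mem_compl_iff, Set.mem_ofPred_eq, Isolated, not_forall, not_lt] at hg
    obtain ⟨j, hj, -, hd⟩ := hg
    simp only [Set.mem_iUnion]
    exact ⟨j, by simpa using hj, hd⟩
  refine (measureReal_mono hsub (measure_ne_top _ _)).trans ((measureReal_biUnion_finset_le _ _).trans ?_)
  have h1 : ∀ j ∈ Finset.univ.erase i, (unitBallPi E (70 * ℓ)).real
      {g | hammingDist (signCode g (x u i)) (signCode g (x u j)) ≤ 28 * ℓ} ≤ (1 / 4) ^ ℓ :=
    fun j hj => signCode_far ℓ hi (hx i j (Finset.ne_of_mem_erase hj).symm)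
  refine (Finset.sum_le_sum h1).trans ?_
  rw [Finset.sum_const, nsmul_eq_mul, Finset.card_erase_of_mem (Finset.mem_univ i),
    Finset.card_univ, Fintype.card_fin]
  have h2 : (k : ℝ) ≤ 2 ^ ℓ := by exact_mod_cast Nat.le_pow_clog (by norm_num) k
  have h3 : ((k - 1 : ℕ) : ℝ) ≤ k := by exact_mod_cast Nat.sub_le k 1
  have h4 : (1 / 4 : ℝ) ^ ℓ ≤ 1 / (k * k) := by
    rw [one_div_pow]
    refine one_div_le_one_div_of_le (by positivity) ?_
    calc (k : ℝ) * k ≤ 2 ^ ℓ * 2 ^ ℓ := by gcongr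
      _ = 4 ^ ℓ := by rw [← mul_pow]; norm_num
  calc ((k - 1 : ℕ) : ℝ) * (1 / 4) ^ ℓ ≤ k * (1 / (k * k)) := by gcongr
    _ = 1 / k := by field_simp

/-- The codes of `(u, i)` and `(v, j)` are close to each other and to no other code. -/
def goodCodes (x : V → Fin k → E) (u v : V) (i j : Fin k) : Set (Fin (70 * Nat.clog 2 k) → E) :=
  {g | hammingDist (signCode g (x u i)) (signCode g (x v j)) ≤ 14 * Nat.clog 2 k} ∩
    ({g | Isolated g x (28 * Nat.clog 2 k) u i} ∩ {g | Isolated g x (28 * Nat.clog 2 k) v j})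

omit [FiniteDimensional ℝ E] in
theorem measurableSet_goodCodes (x : V → Fin k → E) (u v : V) (i j : Fin k) :
    MeasurableSet (goodCodes x u v i j) :=
  (measurableSet_hammingDist_signCode_le _ _ _).inter
    ((measurableSet_isolated _ _ _ _).inter (measurableSet_isolated _ _ _ _))

theorem le_goodCodes (hk : 24 ≤ k) {x : V → Fin k → E}
    (hx : ∀ u i j, i ≠ j → inner ℝ (x u i) (x u j) = 0) {u v : V} {i j : Fin k}
    (h : SmallAngle (x u i) (x v j)) :
    1 / 12 ≤ (unitBallPi E (70 * Nat.clog 2 k)).real (goodCodes x u v i j) := by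
  have h1 := signCode_close (Nat.clog_pos one_lt_two (by omega : 2 ≤ k)) h.1 h.2.1 h.2.2
  have h2 := isolated_compl_le u (hx u) i h.1
  have h3 := isolated_compl_le v (hx v) j h.2.1
  unfold goodCodes
  set A := {g : Fin (70 * Nat.clog 2 k) → E |
    hammingDist (signCode g (x u i)) (signCode g (x v j)) ≤ 14 * Nat.clog 2 k}
  set B := {g : Fin (70 * Nat.clog 2 k) → E | Isolated g x (28 * Nat.clog 2 k) u i}
  set C := {g : Fin (70 * Nat.clog 2 k) → E | Isolated g x (28 * Nat.clog 2 k) v j}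
  have hsub : A ⊆ A ∩ (B ∩ C) ∪ (Bᶜ ∪ Cᶜ) := by
    intro g hg
    by_cases hB : g ∈ B
    · by_cases hC : g ∈ C
      · exact Or.inl ⟨hg, hB, hC⟩
      · exact Or.inr (Or.inr hC)
    · exact Or.inr (Or.inl hB)
  have h4 := (measureReal_mono (μ := unitBallPi E (70 * Nat.clog 2 k)) hsub).trans
    ((measureReal_union_le _ _).trans (add_le_add_right (measureReal_union_le Bᶜ Cᶜ) _))
  have hk' : (24 : ℝ) ≤ k := by exact_mod_cast hk
  have h5 : (1 : ℝ) / k ≤ 1 / 24 := one_div_le_one_div_of_le (by norm_num) hk'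
  -- `1 / 6 - 2 / 24 = 1 / 12`.
  linarith

open Classical in
/-- The encoding by signs of the labels whose vectors are longer than `√t` and isolated. -/
noncomputable def signEncoding {d : ℕ} (g : Fin d → E) (x : V → Fin k → E) (r : ℕ) (t : ℝ) :
    PartialEncoding V k d := fun p =>
  if t < ‖x p.1 p.2‖ ^ 2 ∧ Isolated g x r p.1 p.2 then some (signCode g (x p.1 p.2)) else none

omit [FiniteDimensional ℝ E] [MeasurableSpace E] [BorelSpace E] in
theorem signEncoding_eq_some {d : ℕ} {g : Fin d → E} {x : V → Fin k → E} {r : ℕ} {t : ℝ}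
    {p : V × Fin k} {a : Fin d → Bool} (h : signEncoding g x r t p = some a) :
    (t < ‖x p.1 p.2‖ ^ 2 ∧ Isolated g x r p.1 p.2) ∧ signCode g (x p.1 p.2) = a := by
  unfold signEncoding at h
  split_ifs at h with hc
  exact ⟨hc, Option.some_injective _ h⟩

omit [FiniteDimensional ℝ E] [MeasurableSpace E] [BorelSpace E] in
theorem signEncoding_separated {d : ℕ} (g : Fin d → E) (x : V → Fin k → E) (r : ℕ) {t : ℝ}
    (ht : 0 ≤ t) : (signEncoding g x r t).Separated r := by
  intro u i j a b hij ha hb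
  obtain ⟨⟨-, hi⟩, rfl⟩ := signEncoding_eq_some ha
  obtain ⟨⟨hj, -⟩, rfl⟩ := signEncoding_eq_some hb
  -- Isolation only concerns nonzero vectors; a label with a word has squared norm above `t ≥ 0`.
  refine hi j hij.symm fun h0 => ?_
  simp only [h0, norm_zero] at hj
  norm_num at hj
  linarith

open Classical in
omit [FiniteDimensional ℝ E] [MeasurableSpace E] [BorelSpace E] in
theorem card_labels_signEncoding_le {d : ℕ} (g : Fin d → E) (x : V → Fin k → E) (r : ℕ) (t : ℝ)
    (u : V) : (((signEncoding g x r t).labels u).card : ℝ) ≤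
      ∑ i, (Set.Ioi t).indicator 1 (‖x u i‖ ^ 2) := by
  simp only [Set.indicator_apply, Set.mem_Ioi, Pi.one_apply]
  rw [Finset.sum_boole]
  refine Nat.cast_le.2 (Finset.card_le_card fun i hi => ?_)
  simp only [PartialEncoding.labels, Finset.mem_filter, Finset.mem_univ, true_and] at hi ⊢
  obtain ⟨a, ha⟩ := Option.isSome_iff_exists.1 hi
  exact (signEncoding_eq_some ha).1.1

open Classical in
/-- A solution that makes many edges short gives an encoding with many matches. -/
theorem exists_separated_le_excess {ι : Type*} [Fintype ι] [Fintype V] (hk : 24 ≤ k)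
    {x : V → Fin k → E} (hsum : ∀ u, ∑ i, ‖x u i‖ ^ 2 = 1)
    (hx : ∀ u i j, i ≠ j → inner ℝ (x u i) (x u j) = 0) (s t : ι → V)
    (ρ : ι → Equiv.Perm (Fin k)) (H : Finset ι)
    (hH : ∀ e ∈ H, 1 / 2 * ∑ i, ‖x (s e) i - x (t e) (ρ e i)‖ ^ 2 ≤ 1 / 16) :
    ∃ f : PartialEncoding V k (70 * Nat.clog 2 k), f.Separated (2 * (14 * Nat.clog 2 k)) ∧
      (H.card : ℝ) / 48 - 400 * Fintype.card V - Fintype.card ι / Real.sqrt k ≤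
        f.excess (14 * Nat.clog 2 k) s t ρ := by
  set ℓ := Nat.clog 2 k
  set w : ι × Fin k → ℝ := fun p => if p.1 ∈ H ∧ SmallAngle (x (s p.1) p.2)
    (x (t p.1) (ρ p.1 p.2)) then min (‖x (s p.1) p.2‖ ^ 2) (‖x (t p.1) (ρ p.1 p.2)‖ ^ 2) else 0
    with hw
  set A : ι × Fin k → Set (Fin (70 * ℓ) → E) := fun p =>
    goodCodes x (s p.1) (t p.1) p.2 (ρ p.1 p.2)
  have hwH : (H.card : ℝ) / 4 ≤ ∑ p, w p := by
    rw [Fintype.sum_prod_type]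
    calc (H.card : ℝ) / 4 = ∑ e ∈ H, (1 / 4 : ℝ) := by
          rw [Finset.sum_const, nsmul_eq_mul]; ring
      _ ≤ ∑ e ∈ H, ∑ i, w (e, i) := by
          refine Finset.sum_le_sum fun e he => ?_
          have h1 : ∑ i, ((‖x (s e) i‖ ^ 2 + ‖x (t e) (ρ e i)‖ ^ 2) / 4 -
              2 * ‖x (s e) i - x (t e) (ρ e i)‖ ^ 2) ≤ ∑ i, w (e, i) :=
            Finset.sum_le_sum fun i _ =>
              (le_min_norm_sq_of_smallAngle _ _).trans_eq (by simp [hw, he])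
          refine le_trans ?_ h1
          rw [Finset.sum_sub_distrib, ← Finset.sum_div, Finset.sum_add_distrib, hsum,
            Equiv.sum_comp (ρ e) (fun j => ‖x (t e) j‖ ^ 2), hsum, ← Finset.mul_sum]
          -- Each short edge contributes at least `2 / 4 - 2 * (1 / 8) = 1 / 4`.
          linarith [hH e he]
      _ ≤ ∑ e, ∑ i, w (e, i) := by
          refine Finset.sum_le_sum_of_subset_of_nonneg (Finset.subset_univ _) fun e _ _ =>
            Finset.sum_nonneg fun i _ => ?_
          simp only [hw]
          split_ifs
          · positivity
          · exact le_rfl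
  obtain ⟨g, hg⟩ := exists_le_sum_indicator (unitBallPi E (70 * ℓ)) w A
    fun p => measurableSet_goodCodes _ _ _ _ _
  have hg' : (H.card : ℝ) / 48 ≤ ∑ p, w p * (A p).indicator 1 g := by
    refine le_trans ?_ hg
    calc (H.card : ℝ) / 48 ≤ ∑ p, w p * (1 / 12) := by rw [← Finset.sum_mul]; linarith
      _ ≤ _ := by
        refine Finset.sum_le_sum fun p _ => ?_
        by_cases hp : p.1 ∈ H ∧ SmallAngle (x (s p.1) p.2) (x (t p.1) (ρ p.1 p.2))
        · simp only [hw, if_pos hp]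
          exact mul_le_mul_of_nonneg_left (le_goodCodes hk hx hp.2) (by positivity)
        · simp [hw, hp]
  have hle (u : V) (i : Fin k) : ‖x u i‖ ^ 2 ≤ 1 := by
    rw [← hsum u]
    exact Finset.single_le_sum (f := fun i => ‖x u i‖ ^ 2) (fun _ _ => by positivity)
      (Finset.mem_univ i)
  let Q : ι × Fin k → Prop := fun p =>
    p.1 ∈ H ∧ SmallAngle (x (s p.1) p.2) (x (t p.1) (ρ p.1 p.2)) ∧ g ∈ A p
  -- One threshold must serve three counts at once: matches with weight 1, encoded labels with
  -- weight `-200`, encoded labels over the edges with weight `-1 / √k`. Both ends of a match pass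
  -- when the minimum of their squared norms does, and the negative terms average to `-200 * |V|`
  -- and `-|ι| / √k`.
  obtain ⟨θ, hθ, hle2⟩ := exists_threshold
    (ι := (ι × Fin k) ⊕ (V × Fin k) ⊕ (ι × Fin k))
    (Sum.elim (fun p => if Q p then 1 else 0)
      (Sum.elim (fun _ => -200) fun _ => -(1 / Real.sqrt k)))
    (Sum.elim (fun p => min (‖x (s p.1) p.2‖ ^ 2) (‖x (t p.1) (ρ p.1 p.2)‖ ^ 2))
      (Sum.elim (fun p => ‖x p.1 p.2‖ ^ 2) fun p => ‖x (s p.1) p.2‖ ^ 2))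
    (by rintro (p | p | p) <;> simp only [Sum.elim_inl, Sum.elim_inr] <;> positivity)
    (by
      rintro (p | p | p)
      · exact (min_le_left _ _).trans (hle _ _)
      · exact hle _ _
      · exact hle _ _)
  simp only [Fintype.sum_sum_type, Sum.elim_inl, Sum.elim_inr, ← Finset.mul_sum,
    Fintype.sum_prod_type, hsum, Finset.sum_const, Finset.card_univ, nsmul_eq_mul, mul_one] at hle2
  set f := signEncoding g x (28 * ℓ) θ
  have hfs : f.Separated (2 * (14 * ℓ)) := by
    rw [show 2 * (14 * ℓ) = 28 * ℓ by ring]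
    exact signEncoding_separated g x _ hθ
  refine ⟨f, hfs, ?_⟩
  have hw2 : ∑ p, w p * (A p).indicator 1 g = ∑ e, ∑ i, (if Q (e, i) then (1 : ℝ) else 0) *
      min (‖x (s e) i‖ ^ 2) (‖x (t e) (ρ e i)‖ ^ 2) := by
    rw [Fintype.sum_prod_type]
    refine Finset.sum_congr rfl fun e _ => Finset.sum_congr rfl fun i _ => ?_
    by_cases h1 : e ∈ H ∧ SmallAngle (x (s e) i) (x (t e) (ρ e i)) <;>
      by_cases h2 : g ∈ A (e, i) <;> simp [hw, Q, h1, h2, ← and_assoc]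
  have hN : ∑ u, ((f.labels u).card : ℝ) ≤ ∑ u, ∑ i, (Set.Ioi θ).indicator 1 (‖x u i‖ ^ 2) :=
    Finset.sum_le_sum fun u _ => card_labels_signEncoding_le g x _ θ u
  have hP : ∑ e, ((f.labels (s e)).card : ℝ) ≤
      ∑ e, ∑ i, (Set.Ioi θ).indicator 1 (‖x (s e) i‖ ^ 2) :=
    Finset.sum_le_sum fun e _ => card_labels_signEncoding_le g x _ θ (s e)
  have hM : ∑ e, ∑ i, (if Q (e, i) then (1 : ℝ) else 0) *
      (Set.Ioi θ).indicator 1 (min (‖x (s e) i‖ ^ 2) (‖x (t e) (ρ e i)‖ ^ 2)) ≤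
        f.matchCount (14 * ℓ) s t ρ := by
    rw [PartialEncoding.matchCount, Nat.cast_sum]
    refine Finset.sum_le_sum fun e _ => ?_
    rw [Finset.card_filter, Nat.cast_sum]
    refine Finset.sum_le_sum fun i _ => ?_
    by_cases hQ : Q (e, i)
    · by_cases hm : θ < min (‖x (s e) i‖ ^ 2) (‖x (t e) (ρ e i)‖ ^ 2)
      · rw [lt_min_iff] at hm
        obtain ⟨-, -, hd, hi, hj⟩ := id hQ
        have : f.Near (14 * ℓ) (s e, i) (t e, ρ e i) :=
          ⟨_, _, if_pos ⟨hm.1, hi⟩, if_pos ⟨hm.2, hj⟩, hd⟩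
        simp [this, hQ, hm.1, hm.2]
      · rw [Set.indicator_of_notMem (mt Set.mem_Ioi.1 hm), mul_zero]
        exact Nat.cast_nonneg _
    · rw [if_neg hQ, zero_mul]
      exact Nat.cast_nonneg _
  have hP' := div_le_div_of_nonneg_right hP (Real.sqrt_nonneg k)
  rw [PartialEncoding.excess]
  rw [hw2] at hg'
  have hdiv (y : ℝ) : -(1 / Real.sqrt k) * y = -(y / Real.sqrt k) := by ring
  simp only [hdiv] at hle2
  linarith

end Rounding

/-! ### Comparison of the two bounds. -/

theorem mainTheorem4 :
    ∃ (k₀ : ℕ) (c C : ℝ) (δ : ℕ → ℝ), 0 < c ∧ 0 < C ∧ Tendsto δ atTop (𝓝 0) ∧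
      ∀ (n k : ℕ) (ε γ : ℝ), k₀ ≤ k → 0 < ε → ε ≤ 1 →
        c * ε / Real.sqrt k < γ → γ < 1 / Real.log k →
      ∀ (G : SimpleGraph (Fin n)) [DecidableRel G.Adj] (I : UniqueGame G k)
        (S : Finset (Sym2 (Fin n))),
        C * γ⁻¹ * n ≤ (G.edgeFinset.card : ℝ) →
        S ⊆ G.edgeFinset →
        (S.card : ℝ) = ε * G.edgeFinset.card →
        1 - δ n ≤ (I.randomCorruption (S : Set (Sym2 (Fin n)))).real
          {J | ∀ (m : ℕ) (x : Fin n → Fin k → EuclideanSpace ℝ (Fin m)), IsSDPSolution x →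
            (({e | e ∈ S ∧ J.IsShort x (1 / 16) e}.ncard : ℕ) : ℝ) <
              γ * G.edgeFinset.card} := by
  -- With `96 = 2 * 48` and `38400 = 96 * 400`, each of the losses `|S| / √k` and `400 * n` is at
  -- most `γ|E| / 96`, half of the gain `γ|E| / 48`.
  refine ⟨1024, 96, 38400, fun n => (1 / 2) ^ n, by norm_num, by norm_num,
    tendsto_pow_atTop_nhds_zero_of_lt_one (by norm_num) (by norm_num), ?_⟩
  classical
  intro n k ε γ hk hε _ hγ _ G _ I S hE hS hcard
  have hk0 : (0 : ℝ) < k := by exact_mod_cast (by omega : 0 < k)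
  have hsq : 0 < Real.sqrt k := Real.sqrt_pos.2 hk0
  have hγ0 : 0 < γ := lt_trans (by positivity) hγ
  obtain ⟨δ, hδ⟩ := UniqueGame.exists_dart_of_subset_edgeSet (G := G) (S := (S : Set (Sym2 (Fin n))))
    (fun e he => SimpleGraph.mem_edgeFinset.1 (hS he))
  set Good : Set (UniqueGame G k) :=
    {J | ∀ (m : ℕ) (x : Fin n → Fin k → EuclideanSpace ℝ (Fin m)), IsSDPSolution x →
      (({e | e ∈ S ∧ J.IsShort x (1 / 16) e}.ncard : ℕ) : ℝ) < γ * G.edgeFinset.card} with hGood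
  set s : ↥(S : Set (Sym2 (Fin n))) → Fin n := fun e => (δ e).fst
  set t : ↥(S : Set (Sym2 (Fin n))) → Fin n := fun e => (δ e).snd
  have hbad : (I.randomCorruption (S : Set (Sym2 (Fin n)))).real Goodᶜ ≤ (1 / 2) ^ n := by
    refine I.randomCorruption_real_le δ hδ _
      (fun ρ => ∑ f : PartialEncoding (Fin n) k (70 * Nat.clog 2 k) with
        f.Separated (2 * (14 * Nat.clog 2 k)),
        Real.exp (Real.log k / 2 * f.excess (14 * Nat.clog 2 k) s t ρ))
      (fun ρ => Finset.sum_nonneg fun _ _ => (Real.exp_pos _).le) (fun J hJ => ?_) ?_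
    -- A bad instance has a separated encoding of nonnegative excess, and its single term already
    -- makes the sum at least 1.
    · simp only [hGood, Set.mem_compl_iff, Set.mem_ofPred_eq, not_forall, not_lt] at hJ
      obtain ⟨m, x, hx, hJ⟩ := hJ
      set H : Finset ↥(S : Set (Sym2 (Fin n))) :=
        {e | J.length x (δ e) ≤ 1 / 16} with hH
      have hHc : {e | e ∈ S ∧ J.IsShort x (1 / 16) e}.ncard ≤ H.card := by
        rw [← Set.ncard_coe_finset]
        refine (Set.ncard_le_ncard (t := Subtype.val '' (H : Set ↥(S : Set (Sym2 (Fin n))))) ?_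
          (Set.toFinite _)).trans (Set.ncard_image_le (Set.toFinite _))
        rintro e ⟨he, d, hd, hl⟩
        refine ⟨⟨e, he⟩, ?_, rfl⟩
        rw [Finset.mem_coe, hH, Finset.mem_filter_univ]
        rcases (SimpleGraph.dart_edge_eq_iff _ _).1 (hd.trans (hδ ⟨e, he⟩).symm) with h | h
        · rwa [← h]
        · rwa [h, J.length_symm] at hl
      obtain ⟨f, hf, hle⟩ := exists_separated_le_excess (by omega) hx.sum_norm_sq hx.inner_eq_zero
        s t (fun e => J.perm (δ e)) H fun e he => by
          rw [hH, Finset.mem_filter_univ] at he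
          exact he
      have h1 : γ * G.edgeFinset.card ≤ H.card := hJ.trans (by exact_mod_cast hHc)
      have h2 : 38400 * (n : ℝ) ≤ γ * G.edgeFinset.card := by
        rw [mul_assoc, mul_comm, mul_assoc, inv_mul_le_iff₀ hγ0] at hE
        linarith
      have h3 : (Fintype.card ↥(S : Set (Sym2 (Fin n))) : ℝ) / Real.sqrt k ≤
          γ * G.edgeFinset.card / 96 := by
        have h4 : Fintype.card ↥(S : Set (Sym2 (Fin n))) = S.card := by simp
        rw [h4, hcard]
        have h5 : (0 : ℝ) ≤ G.edgeFinset.card := Nat.cast_nonneg _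
        have h6 := mul_le_mul_of_nonneg_right hγ.le h5
        calc ε * G.edgeFinset.card / Real.sqrt k
            = 96 * ε / Real.sqrt k * G.edgeFinset.card / 96 := by ring
          _ ≤ _ := by gcongr
      have h4 : 0 ≤ f.excess (14 * Nat.clog 2 k) s t fun e => J.perm (δ e) := by
        refine le_trans ?_ hle
        rw [Fintype.card_fin]
        linarith
      have hlog : 0 ≤ Real.log k / 2 := (Real.exp_pos 1).le.trans
        (PartialEncoding.exp_one_le_half_log hk)
      refine (Real.one_le_exp (mul_nonneg hlog h4)).trans ?_
      exact Finset.single_le_sum (f := fun f : PartialEncoding (Fin n) k (70 * Nat.clog 2 k) =>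
        Real.exp (Real.log k / 2 * f.excess (14 * Nat.clog 2 k) s t fun e => J.perm (δ e)))
        (fun _ _ => (Real.exp_pos _).le) (Finset.mem_filter.2 ⟨Finset.mem_univ f, hf⟩)
    · have := PartialEncoding.sum_separated_sum_exp_excess_le hk
        (PartialEncoding.two_pow_seventy_mul_clog_le hk) s t (14 * Nat.clog 2 k)
      rw [Fintype.card_fin] at this
      convert this
  have hcompl := probReal_compl_eq_one_sub (μ := I.randomCorruption (S : Set (Sym2 (Fin n))))
    (MeasurableSet.of_discrete (s := Good))
  rw [hcompl] at hbad
  linarith
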